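/- Let $n\ge 100$ and let $\mathcal D_n$ be the family of all directed graphs without self-loops on the vertex set $[n]=\{0,1,\dots,n-1\}$ (anti-parallel edges are allowed). An $L$-bit adjacency labeling scheme for $\mathcal D_n$ is a pair of functions $\mathrm{Label}:\mathcal D_n\to([n]\to\{0,1\}^L)$ and $\mathrm{Edge}:\{0,1\}^L\times\{0,1\}^L\to\{0,1\}$ such that for every $G=([n],E)\in\mathcal D_n$ and all $u,v\in[n]$ we have $(u,v)\in E$ if and only if $\mathrm{Edge}(\mathrm{Label}(G)(u),\mathrm{Label}(G)(v))=1$. The scheme is indexing if there is a function $\mathrm{Ind}:\{0,1\}^L\to[n]$ such that $\mathrm{Ind}(\mathrm{Label}(G)(u))\ne\mathrm{Ind}(\mathrm{Label}(G)(v))$ for every $G\in\mathcal D_n$ and all distinct $u,v\in[n]$ (so that, in particular, distinct vertices of the same graph receive distinct labels). Then there is an indexing $(n+3)$-bit adjacency labeling scheme for $\mathcal D_n$. This is within an additive constant of optimal: every $L$-bit adjacency labeling scheme for $\mathcal D_n$, indexing or not, has $L\ge n$. -/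

import Mathlib

/-- The family of directed graphs without self-loops on the vertex set `{0, …, n - 1}`. -/
def looplessDigraphs (n : ℕ) : Set (Digraph (Fin n)) :=
  {G | ∀ v, ¬ G.Adj v v}

/-- An `L`-bit adjacency labeling scheme for a family `F` of graphs on the vertex set
`{0, …, n - 1}`: an encoder assigning an `L`-bit label to every vertex of every graph of `F`, and a
decoder, which depends only on the family, deciding from two labels alone whether there is an edge
from the vertex carrying the first label to the vertex carrying the second. -/
structure AdjLabelingScheme {n : ℕ} (F : Set (Digraph (Fin n))) (L : ℕ) where
  label : F → Fin n → (Fin L → Bool)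
  edge : (Fin L → Bool) → (Fin L → Bool) → Bool
  adj_iff : ∀ (G : F) (u v : Fin n), G.1.Adj u v ↔ edge (label G u) (label G v) = true

/-- A scheme is indexing if an index in `{0, …, n - 1}` can be read off every label in such a way
that distinct vertices of one graph always get distinct indices; in particular distinct vertices of
one graph get distinct labels. -/
def AdjLabelingScheme.IsIndexing {n : ℕ} {F : Set (Digraph (Fin n))} {L : ℕ}
    (S : AdjLabelingScheme F L) : Prop :=
  ∃ ind : (Fin L → Bool) → Fin n,
    ∀ (G : F) (u v : Fin n), u ≠ v → ind (S.label G u) ≠ ind (S.label G v)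

/-!
**Upper bound.** Choose `k` with `2 ^ (k + 3) < 3 * n ≤ 2 ^ (k + 4)`, call `k` of the vertices
pivots and let `N = n - k`. Every label names a position, which is a pivot or one of the `N`
ordinary places, and the remaining bits hold (part of) the row of the vertex at that position. The
name of the position costs about `log n` bits, so about `log n` bits have to be saved on the
row. They are the bits telling to which pivots an ordinary vertex `u` has an edge.

The encoder is free to place the ordinary vertices in any order. It sorts them by the rank of their
`k`-bit vector of edges to the pivots in the reflected Gray code. Bit `b` of the Gray code word of
rank `r` is the parity of `(r + 2 ^ b) / 2 ^ (b + 1)` (`exists_gray_rank`), so along the sorted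
order the column of pivot `b` changes its value at most `m = 2 ^ (k - 1 - b)` times
(`exists_perm_forall_parity_changes`). The set of places where it changes is stored in the label of
the pivot; together with the place of `u` it determines whether there is an edge from `u` to the
pivot, and the label of `u` stores nothing about it. There are at most
`(3 * N / m) ^ m ≤ 2 ^ (m * (b + 5))` change sets (`card_changeSets_le`). To make room for them,
pivot `b` hands over `lentBits k b` bits of its own row, each to the ordinary vertex at the other
end. The lent bits are spread over the ordinary places cyclically, hence evenly
(`sum_two_pow_card_wrapRel_col`), and counting the labels gives at most `2 ^ (n + 3)`
(`card_richLabel_le`).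

**Lower bound.** A scheme with `L` bits maps the `2 ^ (n * (n - 1))` graphs injectively to functions
from the vertices to labels, of which there are `2 ^ (L * n)`. Therefore `n - 1 ≤ L`, and equality
would make the map bijective. But a constant function can only come from the empty graph, as the
vertices of the graph have no loops, and there is more than one constant function.
-/

/-! ### Columns of the reflected Gray code -/

/-- Every bit vector is a reflected Gray code word: it has a rank `r`, from which bit `b` is read
off as the parity of `(r + 2 ^ b) / 2 ^ (b + 1)`. This quotient is monotone in `r` and at most
`2 ^ (k - 1 - b)`, which is what bounds the number of changes in a sorted column. -/
theorem exists_gray_rank (k : ℕ) (s : ℕ → Bool) :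
    ∃ r < 2 ^ k, ∀ b < k, s b = true ↔ Odd ((r + 2 ^ b) / 2 ^ (b + 1)) := by
  induction k generalizing s with
  | zero => exact ⟨0, by simp, by simp⟩
  | succ k ih =>
    obtain ⟨r, hr, h⟩ := ih fun b => s (b + 1)
    -- the rank is `2 * r + c`: the last digit `c` affects bit `0` only
    obtain ⟨c, hc, hodd⟩ : ∃ c < 2, s 0 = true ↔ Odd (r + c) := by
      by_cases h0 : (s 0 = true ↔ Odd r)
      · exact ⟨0, by simp, by simpa using h0⟩
      · exact ⟨1, by simp, by rw [Nat.odd_add_one]; tauto⟩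
    refine ⟨2 * r + c, by rw [pow_succ]; omega, fun b hb => ?_⟩
    cases b with
    | zero =>
      rw [hodd, show (2 * r + c + 2 ^ 0) / 2 ^ (0 + 1) = r + c by norm_num; omega]
    | succ b =>
      have : (2 * r + c + 2 ^ (b + 1)) / 2 ^ (b + 1 + 1) = (r + 2 ^ b) / 2 ^ (b + 1) := by
        rw [pow_succ' 2 (b + 1), ← Nat.div_div_eq_div_mul]
        congr 1
        rw [pow_succ]
        omega
      rw [this]
      exact h b (by omega)

theorem card_parity_changes (p : ℕ → ℕ) (hp : Monotone p) (h0 : p 0 = 0) (n : ℕ) :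
    ((Finset.range n).filter fun x => ¬(Odd (p (x + 1)) ↔ Odd (p x))).card ≤ p n ∧
      (Odd ((Finset.range n).filter fun x => ¬(Odd (p (x + 1)) ↔ Odd (p x))).card ↔
        Odd (p n)) := by
  induction n with
  | zero => simp [h0]
  | succ n ih =>
    rw [Finset.range_add_one, Finset.filter_insert]
    have hle : p n ≤ p (n + 1) := hp n.le_succ
    split_ifs with h
    · exact ⟨ih.1.trans hle, by rw [ih.2, h]⟩
    · rw [Finset.card_insert_of_notMem (by simp)]
      have hne : p n ≠ p (n + 1) := fun e => h (by rw [e])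
      refine ⟨by omega, ?_⟩
      rw [Nat.odd_add_one, ih.2]
      tauto

/-- The parity of a monotone function bounded by `m` is determined by the at most `m` places where
it changes, where an odd value at the first place counts as a change. -/
theorem exists_parity_change_set {N m : ℕ} (q : Fin N → ℕ) (hq : Monotone q)
    (hm : ∀ i, q i ≤ m) :
    ∃ D : Finset (Fin N), D.card ≤ m ∧
      ∀ i, Odd (D.filter (· ≤ i)).card ↔ Odd (q i) := by
  -- `p` is `q` shifted by one place: it starts with the value `0` and ends with the value `m`
  let p : ℕ → ℕ := fun n => if n = 0 then 0 else if h : n - 1 < N then q ⟨n - 1, h⟩ else m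
  have hp : Monotone p := by
    intro a b hab
    by_cases ha : a = 0
    · simp [p, ha]
    have hb : b ≠ 0 := by omega
    simp only [p, ha, hb, if_false]
    split_ifs with h1 h2 h2
    · exact hq (by simp only [Fin.mk_le_mk]; omega)
    · exact hm _
    · omega
    · exact le_rfl
  have key := card_parity_changes p hp (by simp [p])
  have hpm : ∀ n, p n ≤ m := by
    intro n
    simp only [p]
    split_ifs
    · exact Nat.zero_le _
    · exact hm _
    · exact le_rfl
  let P : ℕ → Prop := fun x => ¬(Odd (p (x + 1)) ↔ Odd (p x))
  refine ⟨Finset.univ.filter fun i : Fin N => P i, ?_, fun i => ?_⟩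
  · rw [← Finset.card_map Fin.valEmbedding]
    refine (Finset.card_le_card ?_).trans ((key N).1.trans (hpm N))
    intro x
    simp only [Finset.mem_map, Finset.mem_filter, Finset.mem_univ, true_and, Finset.mem_range,
      Fin.valEmbedding_apply]
    rintro ⟨i, hi, rfl⟩
    exact ⟨i.2, hi⟩
  · have hi := (key (i + 1)).2
    have hpi : p (i + 1) = q i := by simp [p]
    rw [hpi] at hi
    rw [← hi, ← Finset.card_map Fin.valEmbedding]
    have : ((Finset.univ.filter fun i : Fin N => P i).filter (· ≤ i)).map Fin.valEmbedding =
        (Finset.range (i + 1)).filter P := by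
      ext x
      simp only [Finset.mem_map, Finset.mem_filter, Finset.mem_univ, true_and, Finset.mem_range,
        Fin.valEmbedding_apply]
      constructor
      · rintro ⟨y, ⟨hy, hyi⟩, rfl⟩
        exact ⟨by have : (y : ℕ) ≤ i := hyi
                  omega, hy⟩
      · rintro ⟨hx, hPx⟩
        exact ⟨⟨x, by omega⟩, ⟨hPx, Fin.le_def.2 (by simp only; omega)⟩, rfl⟩
    rw [this]

/-! ### Counting small sets -/

/-- The tail bound `∑ i ≤ m, N.choose i ≤ (3 * N / m) ^ m`, without division. It follows from
`(1 + x) ^ N ≤ exp (N * x)` at `x = m / N` and `exp 1 ≤ 3`. -/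
theorem sum_choose_mul_pow_le (N m : ℕ) (hm : m ≤ N) :
    (∑ i ∈ Finset.range (m + 1), N.choose i) * m ^ m ≤ (3 * N) ^ m := by
  rcases Nat.eq_zero_or_pos m with rfl | hm0
  · simp
  have hN0 : 0 < N := by omega
  have hN : (0 : ℝ) < N := by exact_mod_cast hN0
  have hx0 : (0 : ℝ) < (m : ℝ) / N := by positivity
  have hx1 : (m : ℝ) / N ≤ 1 := by rw [div_le_one hN]; exact_mod_cast hm
  have h1 : (∑ i ∈ Finset.range (m + 1), (N.choose i : ℝ)) * ((m : ℝ) / N) ^ m ≤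
      ((m : ℝ) / N + 1) ^ N := by
    rw [add_pow, Finset.sum_mul]
    calc _ ≤ ∑ i ∈ Finset.range (m + 1), ((m : ℝ) / N) ^ i * 1 ^ (N - i) * (N.choose i : ℝ) := by
          refine Finset.sum_le_sum fun i hi => ?_
          rw [one_pow, mul_one, mul_comm]
          refine mul_le_mul_of_nonneg_right ?_ (by positivity)
          exact pow_le_pow_of_le_one hx0.le hx1 (by simpa [Nat.lt_succ_iff] using hi)
      _ ≤ _ := Finset.sum_le_sum_of_subset_of_nonneg
          (Finset.range_mono (by omega)) fun _ _ _ => by positivity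
  have h2 : ((m : ℝ) / N + 1) ^ N ≤ 3 ^ m := by
    calc _ ≤ Real.exp ((m : ℝ) / N) ^ N := by
          gcongr
          exact Real.add_one_le_exp _
      _ = Real.exp 1 ^ m := by
          rw [← Real.exp_nat_mul, ← Real.exp_nat_mul]
          congr 1
          field_simp
      _ ≤ _ := by
          gcongr
          exact Real.exp_one_lt_three.le
  have h3 := h1.trans h2
  rw [div_pow, ← mul_div_assoc, div_le_iff₀ (by positivity), ← mul_pow] at h3
  exact_mod_cast h3

theorem card_finset_card_le (N m : ℕ) :
    Fintype.card {D : Finset (Fin N) // D.card ≤ m} =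
      ∑ i ∈ Finset.range (m + 1), N.choose i := by
  rw [Fintype.card_subtype, Finset.card_eq_sum_card_fiberwise (f := Finset.card)
    (t := Finset.range (m + 1))]
  · refine Finset.sum_congr rfl fun i hi => ?_
    have : (Finset.univ.filter fun D : Finset (Fin N) => D.card ≤ m).filter (·.card = i) =
        Finset.powersetCard i Finset.univ := by
      ext D
      simp only [Finset.mem_filter, Finset.mem_univ, true_and, Finset.mem_powersetCard,
        Finset.subset_univ, Finset.mem_range] at hi ⊢
      omega
    rw [this, Finset.card_powersetCard, Finset.card_univ, Fintype.card_fin]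
  · intro D hD
    simp only [Finset.coe_filter, Finset.mem_univ, true_and, Set.mem_ofPred_eq, Finset.coe_range,
      Set.mem_Iio] at hD ⊢
    omega

/-! ### Spreading bits cyclically -/

/-- The sets of places in `{0, …, N - 1}` obtained by walking around the cycle of length `N`: row
`0` consists of the first `s 0` places, row `1` of the next `s 1` ones, and so on. `WrapRel N s j i`
says that place `i` is in row `j`. -/
def WrapRel (N : ℕ) (s : ℕ → ℕ) (j i : ℕ) : Prop :=
  ∃ x < s j, (∑ l ∈ Finset.range j, s l + x) % N = i

theorem eq_of_add_mod_eq {N a s x y : ℕ} (hs : s ≤ N) (hx : x < s) (hy : y < s)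
    (h : (a + x) % N = (a + y) % N) : x = y :=
  Nat.ModEq.eq_of_lt_of_lt (Nat.ModEq.add_left_cancel' a h) (hx.trans_le hs) (hy.trans_le hs)

open Classical in
theorem card_wrapRel_row {N : ℕ} {s : ℕ → ℕ} {j : ℕ} (hs : s j ≤ N) :
    (Finset.univ.filter fun i : Fin N => WrapRel N s j i).card = s j := by
  rw [← Finset.card_map Fin.valEmbedding, ← Finset.card_range (s j),
    ← Finset.card_image_of_injOn (s := Finset.range (s j))
      (f := fun x => (∑ l ∈ Finset.range j, s l + x) % N)]
  · congr 1
    ext y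
    simp only [Finset.mem_map, Finset.mem_filter, Finset.mem_univ, true_and, Finset.mem_image,
      Finset.mem_range, Fin.valEmbedding_apply]
    constructor
    · rintro ⟨i, ⟨x, hx, h⟩, rfl⟩
      exact ⟨x, hx, h⟩
    · rintro ⟨x, hx, rfl⟩
      exact ⟨⟨_, Nat.mod_lt _ (by omega)⟩, ⟨x, hx, rfl⟩, rfl⟩
  · intro x hx y hy h
    exact eq_of_add_mod_eq hs (by simpa using hx) (by simpa using hy) h

open Classical in
/-- Place `i` is in as many of the first `k` rows as the walk, of total length `∑ l < k, s l`, has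
visits to `i`, because no row visits a place twice. -/
theorem card_wrapRel_col {N : ℕ} {s : ℕ → ℕ} (k : ℕ) (hs : ∀ j < k, s j ≤ N) (i : ℕ) :
    ((Finset.range k).filter fun j => WrapRel N s j i).card =
      Nat.count (fun t => t % N = i) (∑ l ∈ Finset.range k, s l) := by
  induction k with
  | zero => simp
  | succ k ih =>
    rw [Finset.sum_range_succ, Nat.count_add, ← ih fun j hj => hs j (by omega),
      Finset.range_add_one, Finset.filter_insert, Nat.count_eq_card_filter_range]
    split_ifs with h
    · rw [Finset.card_insert_of_notMem (by simp)]
      congr 1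
      obtain ⟨x, hx, hxi⟩ := h
      symm
      rw [Finset.card_eq_one]
      refine ⟨x, ?_⟩
      ext y
      simp only [Finset.mem_filter, Finset.mem_range, Finset.mem_singleton]
      constructor
      · rintro ⟨hy, hyi⟩
        exact eq_of_add_mod_eq (hs k k.lt_succ_self) hy hx (hyi.trans hxi.symm)
      · rintro rfl
        exact ⟨hx, hxi⟩
    · symm
      simp only [Nat.add_eq_left, Finset.card_eq_zero, Finset.filter_eq_empty_iff,
        Finset.mem_range]
      exact fun x hx hxi => h ⟨x, hx, hxi⟩

open Classical in
/-- With `T` the total length of the rows, every place is in `T / N` or `T / N + 1` of the rows, and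
in the latter number for exactly `T % N` places. -/
theorem sum_two_pow_card_wrapRel_col {N k : ℕ} {s : ℕ → ℕ} (hN : 0 < N)
    (hs : ∀ j < k, s j ≤ N) :
    ∑ i : Fin N, 2 ^ ((Finset.range k).filter fun j => WrapRel N s j i).card =
      2 ^ ((∑ l ∈ Finset.range k, s l) / N) * (N + (∑ l ∈ Finset.range k, s l) % N) := by
  set T := ∑ l ∈ Finset.range k, s l
  have hr : T % N < N := Nat.mod_lt _ hN
  have h : ∀ i ∈ Finset.range N, 2 ^ ((Finset.range k).filter fun j => WrapRel N s j i).card =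
      2 ^ (T / N) * (1 + if i < T % N then 1 else 0) := by
    intro i hi
    have hi : i < N := by simpa using hi
    have hc := Nat.count_modEq_card T hN i
    simp only [Nat.ModEq, Nat.mod_eq_of_lt hi] at hc
    rw [card_wrapRel_col k hs, hc, pow_add]
    split_ifs <;> rfl
  rw [Fin.sum_univ_eq_sum_range
    (fun i => 2 ^ ((Finset.range k).filter fun j => WrapRel N s j i).card), Finset.sum_congr rfl h,
    ← Finset.mul_sum, Finset.sum_add_distrib, Finset.sum_const, Finset.card_range, smul_eq_mul,
    mul_one, Finset.sum_ite, Finset.sum_const_zero, add_zero, Finset.sum_const, smul_eq_mul,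
    mul_one]
  congr 2
  rw [← Finset.card_range (T % N)]
  congr 1
  ext x
  simp
  omega

/-! ### Sorting by Gray code rank -/

/-- The rows of a Boolean matrix with `k` columns can be permuted in such a way that column `j`
changes its value at most `2 ^ (k - 1 - j)` times from top to bottom; `D j` is the set of the
places where it changes, an entry `true` at the top included. -/
theorem exists_perm_forall_parity_changes {k N : ℕ} (A : Fin N → Fin k → Prop) :
    ∃ (σ : Equiv.Perm (Fin N)) (D : Fin k → Finset (Fin N)),
      (∀ j, (D j).card ≤ 2 ^ (k - 1 - j)) ∧
      ∀ i j, Odd ((D j).filter (· ≤ i)).card ↔ A (σ i) j := by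
  classical
  choose r hr hodd using fun i =>
    exists_gray_rank k fun b => if h : b < k then decide (A i ⟨b, h⟩) else false
  have hmono : Monotone (r ∘ Tuple.sort r) := Tuple.monotone_sort r
  have hD : ∀ j : Fin k, ∃ D : Finset (Fin N), D.card ≤ 2 ^ (k - 1 - j) ∧
      ∀ i, Odd (D.filter (· ≤ i)).card ↔
        Odd ((r (Tuple.sort r i) + 2 ^ (j : ℕ)) / 2 ^ (j + 1 : ℕ)) := by
    intro j
    refine exists_parity_change_set
      (fun i => (r (Tuple.sort r i) + 2 ^ (j : ℕ)) / 2 ^ (j + 1 : ℕ))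
      (fun a b hab => Nat.div_le_div_right (Nat.add_le_add_right (hmono hab) _)) fun i => ?_
    rw [← Nat.lt_succ_iff, Nat.div_lt_iff_lt_mul (by positivity), Nat.succ_mul, ← pow_add]
    have h1 : k - 1 - j + (j + 1) = k := by omega
    have h2 : 2 ^ (j : ℕ) < 2 ^ (j + 1 : ℕ) := Nat.pow_lt_pow_right (by norm_num) (by omega)
    rw [h1]
    have := hr (Tuple.sort r i)
    omega
  choose D hcard hD using hD
  refine ⟨Tuple.sort r, D, hcard, fun i j => ?_⟩
  rw [hD, ← hodd _ _ j.2]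
  simp

/-! ### Labels, encoder and decoder -/

/-- What the label of pivot `j` stores: its edges to the other pivots, its edges to the ordinary
places `i` with `¬ R j i`, and a change set for its column. Its edges to the places `i` with `R j i`
are stored there. -/
abbrev PivotContent {k N : ℕ} (R : Fin k → Fin N → Prop) (m : Fin k → ℕ) (j : Fin k) : Type :=
  ({j' // j' ≠ j} → Bool) × ({i // ¬ R j i} → Bool) × {D : Finset (Fin N) // D.card ≤ m j}

/-- What the label of the vertex at the ordinary place `i` stores: its edges to the other ordinary
places, and the edges to it from the pivots `j` with `R j i`. Its edges to the pivots are not stored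
here. -/
abbrev OrdinaryContent {k N : ℕ} (R : Fin k → Fin N → Prop) (i : Fin N) : Type :=
  ({i' // i' ≠ i} → Bool) × ({j // R j i} → Bool)

/-- Labels before they are written as bit strings: a position together with its content. -/
abbrev RichLabel {k N : ℕ} (R : Fin k → Fin N → Prop) (m : Fin k → ℕ) : Type :=
  (Σ j, PivotContent R m j) ⊕ (Σ i, OrdinaryContent R i)

namespace RichLabel

variable {k N : ℕ} {R : Fin k → Fin N → Prop} {m : Fin k → ℕ}

/-- The position named by a label. -/
def position : RichLabel R m → Fin k ⊕ Fin N
  | .inl ⟨j, _⟩ => .inl j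
  | .inr ⟨i, _⟩ => .inr i

open Classical in
/-- Is there an edge from the vertex with the first label to the vertex with the second one? For an
ordinary vertex and a pivot, the answer is the parity of the number of changes in the column of the
pivot up to the place of the vertex. -/
noncomputable def decode : RichLabel R m → RichLabel R m → Bool
  | .inl ⟨j, c⟩, .inl ⟨j', _⟩ => if h : j' ≠ j then c.1 ⟨j', h⟩ else false
  | .inl ⟨j, c⟩, .inr ⟨i, d⟩ => if h : R j i then d.2 ⟨j, h⟩ else c.2.1 ⟨i, h⟩
  | .inr ⟨i, _⟩, .inl ⟨_, d⟩ => decide (Odd (d.2.2.1.filter (· ≤ i)).card)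
  | .inr ⟨i, c⟩, .inr ⟨i', _⟩ => if h : i' ≠ i then c.1 ⟨i', h⟩ else false

open Classical in
/-- The labels of the positions for the adjacency relation `A`, where `D j` is the change set of the
column of pivot `j`. -/
noncomputable def encode (A : Fin k ⊕ Fin N → Fin k ⊕ Fin N → Prop) (D : Fin k → Finset (Fin N))
    (hD : ∀ j, (D j).card ≤ m j) : Fin k ⊕ Fin N → RichLabel R m
  | .inl j => .inl ⟨j, fun j' => decide (A (.inl j) (.inl j')),
      fun i => decide (A (.inl j) (.inr i)), D j, hD j⟩
  | .inr i => .inr ⟨i, fun i' => decide (A (.inr i) (.inr i')),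
      fun j => decide (A (.inl j) (.inr i))⟩

@[simp] theorem position_encode (A : Fin k ⊕ Fin N → Fin k ⊕ Fin N → Prop)
    (D : Fin k → Finset (Fin N)) (hD : ∀ j, (D j).card ≤ m j) (x : Fin k ⊕ Fin N) :
    (encode A D hD x : RichLabel R m).position = x := by
  cases x <;> rfl

theorem decode_encode {A : Fin k ⊕ Fin N → Fin k ⊕ Fin N → Prop} (hA : ∀ x, ¬ A x x)
    {D : Fin k → Finset (Fin N)} (hD : ∀ j, (D j).card ≤ m j)
    (hDA : ∀ i j, Odd ((D j).filter (· ≤ i)).card ↔ A (.inr i) (.inl j)) (x y : Fin k ⊕ Fin N) :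
    decode (encode A D hD x : RichLabel R m) (encode A D hD y) = true ↔ A x y := by
  rcases x with j | i <;> rcases y with j' | i'
  · by_cases h : j' = j
    · subst h
      simp [encode, decode, hA]
    · simp [encode, decode, h]
  · by_cases h : R j i' <;> simp [encode, decode, h]
  · simp [encode, decode, hDA]
  · by_cases h : i' = i
    · subst h
      simp [encode, decode, hA]
    · simp [encode, decode, h]

end RichLabel

/-- Whatever edges are stored at the other end, the labels give an indexing scheme as soon as there
are few enough of them to be written with `L` bits. -/
theorem exists_isIndexing_of_card_le {k N L : ℕ} (R : Fin k → Fin N → Prop)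
    (hk : 0 < k + N) (hcard : Nat.card (RichLabel R fun j => 2 ^ (k - 1 - j)) ≤ 2 ^ L) :
    ∃ S : AdjLabelingScheme (looplessDigraphs (k + N)) L, S.IsIndexing := by
  classical
  obtain ⟨f⟩ : Nonempty ((RichLabel R fun j => 2 ^ (k - 1 - j)) ↪ (Fin L → Bool)) := by
    rw [Function.Embedding.nonempty_iff_card_le]
    rw [Nat.card_eq_fintype_card] at hcard
    simpa using hcard
  have hG : ∀ G : looplessDigraphs (k + N), ∃ (e : Fin (k + N) ≃ Fin k ⊕ Fin N)
      (D : Fin k → Finset (Fin N)), (∀ j, (D j).card ≤ 2 ^ (k - 1 - j)) ∧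
      ∀ i j, Odd ((D j).filter (· ≤ i)).card ↔
        G.1.Adj (e.symm (.inr i)) (e.symm (.inl j)) := by
    intro G
    obtain ⟨σ, D, hD, h⟩ := exists_perm_forall_parity_changes
      fun (i : Fin N) (j : Fin k) => G.1.Adj (finSumFinEquiv (.inr i)) (finSumFinEquiv (.inl j))
    refine ⟨finSumFinEquiv.symm.trans ((Equiv.refl _).sumCongr σ.symm), D, hD, fun i j => ?_⟩
    rw [h]
    rfl
  choose e D hD h using hG
  let enc : looplessDigraphs (k + N) → Fin (k + N) → RichLabel R fun j => 2 ^ (k - 1 - j) :=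
    fun G u => RichLabel.encode (fun x y => G.1.Adj ((e G).symm x) ((e G).symm y)) (D G) (hD G)
      (e G u)
  have hne : Nonempty (RichLabel R fun j => 2 ^ (k - 1 - j)) :=
    ⟨enc ⟨⟨fun _ _ => False⟩, fun _ h => h⟩ ⟨0, hk⟩⟩
  refine ⟨⟨fun G u => f (enc G u),
    fun a b => RichLabel.decode (Function.invFun f a) (Function.invFun f b), fun G u v => ?_⟩,
    fun a => finSumFinEquiv (Function.invFun f a).position, fun G u v huv => ?_⟩
  · rw [Function.leftInverse_invFun f.injective, Function.leftInverse_invFun f.injective,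
      RichLabel.decode_encode (fun x => G.2 _) (hD G) (h G)]
    simp
  · simpa [Function.leftInverse_invFun f.injective _, enc] using huv

/-! ### Counting the labels -/

/-- The number of bits of its own row that pivot `b` hands over to ordinary vertices. The first
summand makes room for the change set of its column; the second one, of `k - 3` further bits, makes
the labels of all `k` pivots together negligible. -/
def lentBits (k b : ℕ) : ℕ := 2 ^ (k - 1 - b) * (b + 5) + (k - 3)

theorem sum_lentBits (k : ℕ) :
    ∑ b ∈ Finset.range k, lentBits k b + k + 6 = 6 * 2 ^ k + k * (k - 3) := by
  have h : ∀ k, ∑ b ∈ Finset.range k, 2 ^ (k - 1 - b) * (b + 5) + k + 6 = 6 * 2 ^ k := by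
    intro k
    induction k with
    | zero => simp
    | succ k ih =>
      have : ∑ b ∈ Finset.range k, 2 ^ (k + 1 - 1 - b) * (b + 5) =
          2 * ∑ b ∈ Finset.range k, 2 ^ (k - 1 - b) * (b + 5) := by
        rw [Finset.mul_sum]
        refine Finset.sum_congr rfl fun b hb => ?_
        have hb : b < k := by simpa using hb
        rw [show k + 1 - 1 - b = k - 1 - b + 1 by omega, pow_succ]
        ring
      rw [Finset.sum_range_succ, this, pow_succ]
      simp only [Nat.add_sub_cancel, Nat.sub_self, pow_zero, one_mul]
      omega
  have := h k
  simp only [lentBits, Finset.sum_add_distrib, Finset.sum_const, Finset.card_range, smul_eq_mul]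
  omega

theorem lentBits_le {k b : ℕ} (hb : b < k) : 2 * lentBits k b ≤ 5 * 2 ^ k + 2 * (k - 3) := by
  have h1 : b + 5 ≤ 5 * 2 ^ b := by
    have := @Nat.lt_two_pow_self b
    omega
  have h2 : 2 * (2 ^ (k - 1 - b) * 2 ^ b) = 2 ^ k := by
    rw [← pow_add, ← pow_succ']
    congr 1
    omega
  have h3 := Nat.mul_le_mul_left (2 ^ (k - 1 - b)) h1
  unfold lentBits
  nlinarith

theorem card_changeSets_le {k N b : ℕ} (hb : b < k) (hkN : 2 ^ (k - 1 - b) ≤ N)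
    (hN : 3 * N ≤ 2 ^ (k + 4)) :
    Fintype.card {D : Finset (Fin N) // D.card ≤ 2 ^ (k - 1 - b)} ≤
      2 ^ (2 ^ (k - 1 - b) * (b + 5)) := by
  rw [card_finset_card_le]
  set m := 2 ^ (k - 1 - b) with hm
  have hpow : 2 ^ (k + 4) = 2 ^ (b + 5) * m := by
    rw [hm, ← pow_add]
    congr 1
    omega
  refine Nat.le_of_mul_le_mul_right ((sum_choose_mul_pow_le N m hkN).trans ?_)
    (show 0 < m ^ m by positivity)
  calc (3 * N) ^ m ≤ (2 ^ (b + 5) * m) ^ m := by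
        rw [← hpow]
        exact Nat.pow_le_pow_left hN m
    _ = 2 ^ (m * (b + 5)) * m ^ m := by rw [mul_pow, ← pow_mul, mul_comm m (b + 5)]

theorem two_pow_growth {k : ℕ} (hk : 6 ≤ k) :
    12 * k ≤ 2 ^ k + 8 ∧ 3 * (k * k) + 3 ≤ 2 * 2 ^ k + 3 * k := by
  induction k, hk using Nat.le_induction with
  | base => norm_num
  | succ k hk ih => rw [pow_succ]; constructor <;> nlinarith [ih.1, ih.2]

/-- In units of `2 ^ (N - 1)`, the number of labels is at most `8` for each pivot and exactly
`2 ^ h` for an ordinary place to which `h` bits are lent, and `2 ^ (k + 4)` are available. -/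
theorem card_richLabel_le {k N : ℕ} (hk : 5 ≤ k) (hn : 100 ≤ k + N)
    (h1 : 2 ^ (k + 3) < 3 * (k + N)) (h2 : 3 * (k + N) ≤ 2 ^ (k + 4)) :
    Nat.card (RichLabel (fun (j : Fin k) (i : Fin N) => WrapRel N (lentBits k) j i)
      fun j => 2 ^ (k - 1 - j)) ≤ 2 ^ (k + N + 3) := by
  classical
  have hpk : 32 ≤ 2 ^ k := by
    calc 32 = 2 ^ 5 := by norm_num
      _ ≤ _ := Nat.pow_le_pow_right (by norm_num) hk
  have h3 : 2 ^ (k + 3) = 8 * 2 ^ k := by ring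
  have h4 : 2 ^ (k + 4) = 16 * 2 ^ k := by ring
  -- for `k = 5` the bound `100 ≤ k + N` is needed, from `k = 6` on growth is enough
  have hcases : k = 5 ∧ k * k = 25 ∧ 2 ^ k = 32 ∨
      12 * k ≤ 2 ^ k + 8 ∧ 3 * (k * k) + 3 ≤ 2 * 2 ^ k + 3 * k := by
    rcases hk.eq_or_lt with rfl | h
    · exact Or.inl (by norm_num)
    · exact Or.inr (two_pow_growth h)
  have hs : ∀ b < k, lentBits k b ≤ N := by
    intro b hb
    have := lentBits_le hb
    rcases hcases with h | h <;> omega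
  set T := ∑ l ∈ Finset.range k, lentBits k l with hT
  have hTeq : T + 4 * k + 6 = 6 * 2 ^ k + k * k := by
    have := sum_lentBits k
    have hkk : k * (k - 3) + 3 * k = k * k := by
      rw [Nat.mul_sub, mul_comm 3 k]
      have : 3 * k ≤ k * k := Nat.mul_le_mul_right k (by omega)
      omega
    omega
  have hk2 : 5 * k ≤ k * k := Nat.mul_le_mul_right k hk
  have hN : 0 < N := by omega
  have hbudget : 2 ^ (T / N) * (N + T % N) + 8 * k ≤ 2 ^ (k + 4) := by
    have hdm := Nat.div_add_mod T N
    have hlt := Nat.mod_lt T hN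
    have hq1 : 1 ≤ T / N := by rw [Nat.le_div_iff_mul_le hN]; omega
    have hq2 : T / N < 3 := by
      rw [Nat.div_lt_iff_lt_mul hN]
      rcases hcases with h | h <;> omega
    generalize T / N = q at *
    generalize T % N = r at *
    rcases hcases with h | h <;> interval_cases q <;> omega
  have hpivot : ∀ j : Fin k, Fintype.card (PivotContent
      (fun (j : Fin k) (i : Fin N) => WrapRel N (lentBits k) j i)
      (fun j => 2 ^ (k - 1 - j)) j) ≤ 2 ^ (N - 1) * 8 := by
    intro j
    have hC := card_changeSets_le (N := N) j.2
      (by have : lentBits k j ≤ N := hs j j.2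
          unfold lentBits at this
          nlinarith) (by omega)
    have hrow : Fintype.card {i : Fin N // ¬ WrapRel N (lentBits k) j i} = N - lentBits k j := by
      rw [Fintype.card_subtype_compl, Fintype.card_fin, Fintype.card_subtype,
        card_wrapRel_row (hs j j.2)]
    have hcol : Fintype.card {j' : Fin k // j' ≠ j} = k - 1 := by
      simp [Fintype.card_subtype_compl]
    rw [Fintype.card_prod, Fintype.card_prod, Fintype.card_fun, Fintype.card_fun,
      Fintype.card_bool, hrow, hcol]
    calc _ ≤ 2 ^ (k - 1) *
            (2 ^ (N - lentBits k j) * 2 ^ (2 ^ (k - 1 - (j : ℕ)) * ((j : ℕ) + 5))) := by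
          gcongr
      _ = 2 ^ (N - 1) * 2 ^ 3 := by
          rw [← pow_add, ← pow_add, ← pow_add]
          congr 1
          have : lentBits k j ≤ N := hs j j.2
          unfold lentBits at this ⊢
          omega
      _ = _ := by norm_num
  have hord : ∀ i : Fin N, Fintype.card (OrdinaryContent
      (fun (j : Fin k) (i : Fin N) => WrapRel N (lentBits k) j i) i) =
      2 ^ (N - 1) * 2 ^ ((Finset.range k).filter fun j => WrapRel N (lentBits k) j i).card := by
    intro i
    have hcol : Fintype.card {j : Fin k // WrapRel N (lentBits k) j i} =
        ((Finset.range k).filter fun j => WrapRel N (lentBits k) j i).card := by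
      rw [Fintype.card_subtype, Finset.card_filter, Finset.card_filter,
        Fin.sum_univ_eq_sum_range (fun j => if WrapRel N (lentBits k) j i then 1 else 0)]
    have hrow : Fintype.card {i' : Fin N // i' ≠ i} = N - 1 := by
      simp [Fintype.card_subtype_compl]
    rw [Fintype.card_prod, Fintype.card_fun, Fintype.card_fun, Fintype.card_bool, hrow, hcol]
  rw [Nat.card_eq_fintype_card, Fintype.card_sum, Fintype.card_sigma, Fintype.card_sigma,
    Finset.sum_congr rfl fun i _ => hord i, ← Finset.mul_sum, sum_two_pow_card_wrapRel_col hN hs]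
  calc _ ≤ ∑ _j : Fin k, 2 ^ (N - 1) * 8 + 2 ^ (N - 1) * (2 ^ (T / N) * (N + T % N)) :=
        Nat.add_le_add_right (Finset.sum_le_sum fun j _ => hpivot j) _
    _ = 2 ^ (N - 1) * (2 ^ (T / N) * (N + T % N) + 8 * k) := by
        rw [Finset.sum_const, Finset.card_univ, Fintype.card_fin, smul_eq_mul]
        ring
    _ ≤ 2 ^ (N - 1) * 2 ^ (k + 4) := Nat.mul_le_mul_left _ hbudget
    _ = _ := by
        rw [← pow_add]
        congr 1
        omega

theorem exists_pivot_count {n : ℕ} (hn : 100 ≤ n) :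
    ∃ k N, n = k + N ∧ 5 ≤ k ∧ 2 ^ (k + 3) < 3 * n ∧ 3 * n ≤ 2 ^ (k + 4) := by
  have hc1 := Nat.le_pow_clog (b := 2) (by norm_num) (3 * n)
  have hc2 := Nat.pow_pred_clog_lt_self (b := 2) (by norm_num) (x := 3 * n) (by omega)
  have h9 : 9 ≤ Nat.clog 2 (3 * n) := by
    by_contra! h
    have : 2 ^ Nat.clog 2 (3 * n) ≤ 2 ^ 8 := Nat.pow_le_pow_right (by norm_num) (by omega)
    omega
  obtain ⟨k, hk⟩ := Nat.exists_eq_add_of_le' (show 4 ≤ Nat.clog 2 (3 * n) by omega)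
  rw [hk] at hc1 hc2 h9
  have hkn : k ≤ n := by
    have := @Nat.lt_two_pow_self (k + 3)
    rw [Nat.pred_eq_sub_one, show k + 4 - 1 = k + 3 by omega, pow_add] at hc2
    have := @Nat.lt_two_pow_self k
    omega
  exact ⟨k, n - k, by omega, by omega, hc2, hc1⟩

/-! ### The lower bound -/

open Classical in
theorem le_of_adjLabelingScheme_looplessDigraphs {n L : ℕ} (hn : 2 ≤ n)
    (S : AdjLabelingScheme (looplessDigraphs n) L) : n ≤ L := by
  have hinj : Function.Injective S.label := by
    intro G H h
    apply Subtype.ext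
    ext u v
    rw [S.adj_iff, S.adj_iff, h]
  by_contra! hL
  -- a graph all of whose labels agree has no edge
  have hconst : ∀ (G : looplessDigraphs n) (a : Fin L → Bool),
      S.label G = (fun _ => a) → ∀ u v, ¬ G.1.Adj u v := by
    intro G a h u v huv
    have hu := G.2 u
    rw [S.adj_iff, h] at huv hu
    exact hu huv
  -- a loopless digraph amounts to a row of `n - 1` bits for every vertex
  let f : (∀ u : Fin n, {v // v ≠ u} → Bool) → looplessDigraphs n := fun c =>
    ⟨⟨fun u v => ∃ h : v ≠ u, c u ⟨v, h⟩ = true⟩, fun v ⟨h, _⟩ => h rfl⟩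
  have hf : Function.Injective f := by
    intro c d h
    funext u v
    have : (f c).1.Adj u v ↔ (f d).1.Adj u v := by rw [h]
    rw [Bool.eq_iff_iff]
    exact ⟨fun hc => (this.1 ⟨v.2, hc⟩).2, fun hd => (this.2 ⟨v.2, hd⟩).2⟩
  have hcard := Fintype.card_le_of_injective _ (hinj.comp hf)
  have hsurj : ¬ Function.Surjective (S.label ∘ f) → (n - 1) * n < L * n := by
    intro hns
    have := Fintype.card_lt_of_injective_not_surjective _ (hinj.comp hf) hns
    rw [← Nat.pow_lt_pow_iff_right (le_refl 2)]
    simpa [← pow_mul, Fintype.card_subtype_compl] using this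
  have hle : (n - 1) * n ≤ L * n := by
    rw [← Nat.pow_le_pow_iff_right (le_refl 2)]
    simpa [← pow_mul, Fintype.card_subtype_compl] using hcard
  have hL' : L = n - 1 := by
    have := Nat.le_of_mul_le_mul_right hle (by omega)
    omega
  refine absurd (hsurj fun hs => ?_) (by rw [hL']; exact lt_irrefl _)
  obtain ⟨c, hc⟩ := hs fun _ _ => false
  obtain ⟨d, hd⟩ := hs fun _ _ => true
  have hcd : f c = f d := by
    apply Subtype.ext
    ext u v
    exact iff_of_false (hconst _ _ hc u v) (hconst _ _ hd u v)
  have : (fun _ _ => false : Fin n → Fin L → Bool) = fun _ _ => true := by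
    rw [← hc, ← hd, Function.comp_apply, Function.comp_apply, hcd]
  have := congrFun (congrFun this ⟨0, by omega⟩) ⟨0, by omega⟩
  simp at this

/-! ### Optimal labeling of loopless digraphs -/

theorem mainTheorem3 (n : ℕ) (hn : 100 ≤ n) :
    (∃ S : AdjLabelingScheme (looplessDigraphs n) (n + 3), S.IsIndexing) ∧
      ∀ L : ℕ, Nonempty (AdjLabelingScheme (looplessDigraphs n) L) → n ≤ L := by
  refine ⟨?_, fun L ⟨S⟩ => le_of_adjLabelingScheme_looplessDigraphs (by omega) S⟩
  obtain ⟨k, N, rfl, hk, h1, h2⟩ := exists_pivot_count hn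
  exact exists_isIndexing_of_card_le _ (by omega) (card_richLabel_le hk hn h1 h2)
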